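/- Let $\lambda>0$ and let $\mu$ be the measure $d\mu(t)=\operatorname{sh}^{2\lambda}t\,dt$ on $[0,\infty)$ (here $\operatorname{sh}$, $\operatorname{ch}$ are the hyperbolic sine and cosine). For $r>0$ put $H(0,r)=(-r,r)\cap[0,\infty)=[0,r)$ and $|H(0,r)|_\lambda=\mu(H(0,r))=\int_0^r\operatorname{sh}^{2\lambda}t\,dt$. For $1\le p\le\infty$ let $L_{p,\lambda}[0,\infty)$ be the space of real- or complex-valued functions $f$ on $[1,\infty)$ such that $t\mapsto f(\operatorname{ch}t)$ is measurable on $[0,\infty)$ and has finite norm $\left(\int_0^\infty|f(\operatorname{ch}t)|^p\operatorname{sh}^{2\lambda}t\,dt\right)^{1/p}$ if $p<\infty$, respectively $\operatorname{ess\,sup}_{t\ge0}|f(\operatorname{ch}t)|$ if $p=\infty$. For $x,t\ge0$ define the generalized (Gegenbauer) shift $$A^\lambda_{\operatorname{ch}t}f(\operatorname{ch}x)=\frac{\Gamma(\lambda+\frac12)}{\Gamma(\frac12)\Gamma(\lambda)}\int_0^\pi f(\operatorname{ch}x\operatorname{ch}t-\operatorname{sh}x\operatorname{sh}t\cos\varphi)(\sin\varphi)^{2\lambda-1}\,d\varphi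 .$$ If $f\in L_{p,\lambda}[0,\infty)$ with $1\le p\le\infty$, then for almost every $x\in[0,\infty)$ the integral defining $A^\lambda_{\operatorname{ch}t}f(\operatorname{ch}x)$ converges absolutely for almost every $t\ge0$, the function $t\mapsto A^\lambda_{\operatorname{ch}t}f(\operatorname{ch}x)$ is $\mu$-integrable on $H(0,r)$ for every $r>0$, and $$\lim_{r\to0+}\frac1{|H(0,r)|_\lambda}\int_{H(0,r)}A^\lambda_{\operatorname{ch}t}f(\operatorname{ch}x)\,\operatorname{sh}^{2\lambda}t\,dt=f(\operatorname{ch}x).$$ -/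

import Mathlib

open MeasureTheory Filter Topology Set
open scoped ENNReal

/-- The set `H(x, r) = (x - r, x + r) ∩ [0, ∞)`. -/
def gegenbauerH (x r : ℝ) : Set ℝ := Ioo (x - r) (x + r) ∩ Ici 0

/-- The measure `dμ(t) = sh^{2λ} t dt` on the half-line `[0, ∞)`, so that `|E|_λ = μ(E)`. -/
noncomputable def gegenbauerMeasure (lam : ℝ) : Measure ℝ :=
  (volume.restrict (Ici 0)).withDensity
    (fun t => ENNReal.ofReal (Real.sinh t ^ (2 * lam)))

/-- Membership in `L_{p,λ}[0, ∞)`: the function `t ↦ f (ch t)` is measurable on `[0, ∞)` and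
has finite `p`-norm with respect to `sh^{2λ} t dt` (essential supremum for `p = ∞`).
Only the values of `f` on `[1, ∞)` matter. -/
def MemGegenbauerLp {𝕜 : Type*} [RCLike 𝕜] (lam : ℝ) (p : ℝ≥0∞) (f : ℝ → 𝕜) : Prop :=
  MemLp (fun t => f (Real.cosh t)) p (gegenbauerMeasure lam)

/-- The integrand (in the angle `φ`) of the generalized shift,
`f (ch x ch t - sh x sh t cos φ) (sin φ)^{2λ-1}`. -/
noncomputable def gegenbauerShiftIntegrand {𝕜 : Type*} [RCLike 𝕜] (lam : ℝ) (f : ℝ → 𝕜)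
    (t x φ : ℝ) : 𝕜 :=
  (Real.sin φ ^ (2 * lam - 1)) •
    f (Real.cosh x * Real.cosh t - Real.sinh x * Real.sinh t * Real.cos φ)

/-- The generalized (Gegenbauer) shift `A^λ_{ch t} f (ch x)`. -/
noncomputable def gegenbauerShift {𝕜 : Type*} [RCLike 𝕜] (lam : ℝ) (f : ℝ → 𝕜) (t x : ℝ) : 𝕜 :=
  (Real.Gamma (lam + 1 / 2) / (Real.Gamma (1 / 2) * Real.Gamma lam)) •
    ∫ φ in (0 : ℝ)..Real.pi, gegenbauerShiftIntegrand lam f t x φ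

/-! View `t` and `φ` as polar coordinates in a hyperbolic plane, where `ch x ch t - sh x sh t cos φ`
is the `ch` of the distance to the point at distance `x` from the origin. With `u = ch t`, `v = sh t
cos φ`, the measure `sh^{2λ} t (sin φ)^{2λ-1} dt dφ` becomes `(u² - 1 - v²)^{λ-1} du dv`
(`map_hyperbolicPolar`), which is invariant under the Lorentz reflection exchanging the two points
(`map_lorentzReflection`). Hence the distances to these points can be exchanged under the integral
(`map_coshLaw_swap`).

The integral of the shift over `H(0, r)` is, up to the Gamma factor, a double integral of
`f(coshLaw)` over `ch t < ch r`. After the exchange, `f(ch z)` is integrated against the angular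
measure of those `θ` with `coshLaw x (z, θ) < ch r`. This kernel vanishes unless `|x - z| < r`, and
for fixed `x > 0` and small `r` it is `O(r^{2λ})`.

The shift preserves constants, so subtracting `f(ch x)` bounds the error by `r^{2λ}` times the
integral of `|f(ch z) - f(ch x)|` over `[x - r, x + r]`, divided by `|H(0, r)|_λ`. The latter is at
least of order `r^{2λ+1}` and the interval has measure `O(r)`, so a mean oscillation remains. It
tends to `0` at Lebesgue points, hence almost everywhere, since `L_p` functions are locally
integrable. -/

/-- The angular measure `(sin φ)^{2λ-1} dφ` on `(0, π)`. -/
noncomputable def gegenbauerAngleMeasure (lam : ℝ) : Measure ℝ :=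
  (volume.restrict (Ioo 0 Real.pi)).withDensity
    (fun φ => ENNReal.ofReal (Real.sin φ ^ (2 * lam - 1)))

/-- The region `{u > 1, v² < u² - 1}`, parametrized by `u = ch t`, `v = sh t cos φ`. -/
def hyperbolicRegion : Set (ℝ × ℝ) := {q | 1 < q.1 ∧ q.2 ^ 2 < q.1 ^ 2 - 1}

/-- The Lorentz invariant measure `(u² - 1 - v²)^{λ-1} du dv`. -/
noncomputable def lorentzMeasure (lam : ℝ) : Measure (ℝ × ℝ) :=
  (volume.restrict hyperbolicRegion).withDensity
    (fun q => ENNReal.ofReal ((q.1 ^ 2 - 1 - q.2 ^ 2) ^ (lam - 1)))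

/-- Hyperbolic polar coordinates. -/
noncomputable def hyperbolicPolar (p : ℝ × ℝ) : ℝ × ℝ :=
  (Real.cosh p.1, Real.sinh p.1 * Real.cos p.2)

/-- The Lorentz reflection exchanging the points at distance `0` and `x` from the origin. -/
noncomputable def lorentzReflection (x : ℝ) (q : ℝ × ℝ) : ℝ × ℝ :=
  (Real.cosh x * q.1 - Real.sinh x * q.2, Real.sinh x * q.1 - Real.cosh x * q.2)

/-! ### Lorentz invariance of the measure in the coordinates `(u, v)`. -/

lemma measurableSet_hyperbolicRegion : MeasurableSet hyperbolicRegion :=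
  ((isOpen_lt continuous_const continuous_fst).inter
    (isOpen_lt (by fun_prop : Continuous fun q : ℝ × ℝ => q.2 ^ 2)
      (by fun_prop : Continuous fun q : ℝ × ℝ => q.1 ^ 2 - 1))).measurableSet

lemma continuous_hyperbolicPolar : Continuous hyperbolicPolar := by
  unfold hyperbolicPolar
  exact (Real.continuous_cosh.comp continuous_fst).prodMk
    ((Real.continuous_sinh.comp continuous_fst).mul (Real.continuous_cos.comp continuous_snd))

lemma continuous_lorentzReflection (x : ℝ) : Continuous (lorentzReflection x) := by
  unfold lorentzReflection
  fun_prop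

lemma lorentzReflection_involutive (x : ℝ) : Function.Involutive (lorentzReflection x) := by
  rintro ⟨u, v⟩
  have h := Real.cosh_sq x
  ext <;> simp only [lorentzReflection]
  · linear_combination u * h
  · linear_combination v * h

lemma lorentzReflection_quadratic (x : ℝ) (q : ℝ × ℝ) :
    (lorentzReflection x q).1 ^ 2 - 1 - (lorentzReflection x q).2 ^ 2
      = q.1 ^ 2 - 1 - q.2 ^ 2 := by
  have h := Real.cosh_sq x
  simp only [lorentzReflection]
  linear_combination (q.1 ^ 2 - q.2 ^ 2) * h

lemma lorentzReflection_mem {x : ℝ} {q : ℝ × ℝ} (hq : q ∈ hyperbolicRegion) :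
    lorentzReflection x q ∈ hyperbolicRegion := by
  obtain ⟨h1, h2⟩ := hq
  have hQ := lorentzReflection_quadratic x q
  have hpos : 0 < (lorentzReflection x q).1 := by
    simp only [lorentzReflection]
    have hc := Real.cosh_pos x
    have hs := Real.cosh_sq x
    -- The reflection stays on the sheet `u > 0`, because `|v| < u` and `|sh x| < ch x`.
    have hlt : (Real.sinh x * q.2) ^ 2 < (Real.cosh x * q.1) ^ 2 := by
      rw [mul_pow, mul_pow, hs]
      nlinarith [sq_nonneg (Real.sinh x), sq_nonneg q.1]
    have := abs_lt_of_sq_lt_sq hlt (by positivity)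
    linarith [(abs_lt.1 this).2]
  refine ⟨?_, by linarith⟩
  nlinarith [sq_nonneg (lorentzReflection x q).2]

lemma image_lorentzReflection (x : ℝ) :
    lorentzReflection x '' hyperbolicRegion = hyperbolicRegion := by
  apply Subset.antisymm
  · rintro _ ⟨q, hq, rfl⟩
    exact lorentzReflection_mem hq
  · intro q hq
    exact ⟨_, lorentzReflection_mem hq, lorentzReflection_involutive x q⟩

lemma hasFDerivAt_lorentzReflection (x : ℝ) (q : ℝ × ℝ) :
    HasFDerivAt (lorentzReflection x)
      (Matrix.toLin (.finTwoProd ℝ) (.finTwoProd ℝ)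
        !![Real.cosh x, -Real.sinh x; Real.sinh x, -Real.cosh x]).toContinuousLinearMap q := by
  have : lorentzReflection x = (Matrix.toLin (.finTwoProd ℝ) (.finTwoProd ℝ)
        !![Real.cosh x, -Real.sinh x; Real.sinh x, -Real.cosh x]).toContinuousLinearMap := by
    ext p <;> simp [lorentzReflection, Matrix.toLin_finTwoProd] <;> ring
  rw [this]
  exact ContinuousLinearMap.hasFDerivAt _

lemma measurable_lorentzDensity (lam : ℝ) :
    Measurable (fun q : ℝ × ℝ => ENNReal.ofReal ((q.1 ^ 2 - 1 - q.2 ^ 2) ^ (lam - 1))) := by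
  fun_prop

/-- The reflection is linear of determinant `-1` and preserves both the region and the form `u² - 1
- v²`, so the change of variables leaves the density unchanged. -/
theorem map_lorentzReflection (lam x : ℝ) :
    (lorentzMeasure lam).map (lorentzReflection x) = lorentzMeasure lam := by
  refine Measure.ext_of_lintegral _ fun F hF => ?_
  have hL := (continuous_lorentzReflection x).measurable
  rw [lintegral_map hF hL]
  unfold lorentzMeasure
  rw [lintegral_withDensity_eq_lintegral_mul _ (measurable_lorentzDensity lam)
      (show Measurable fun q => F (lorentzReflection x q) from hF.comp hL),
    lintegral_withDensity_eq_lintegral_mul _ (measurable_lorentzDensity lam) hF]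
  conv_rhs => rw [← image_lorentzReflection x]
  rw [lintegral_image_eq_lintegral_abs_det_fderiv_mul volume measurableSet_hyperbolicRegion
    (fun q _ => (hasFDerivAt_lorentzReflection x q).hasFDerivWithinAt)
    (lorentzReflection_involutive x).injective.injOn]
  refine lintegral_congr fun q => ?_
  have hdet : |((Matrix.toLin (.finTwoProd ℝ) (.finTwoProd ℝ)
      !![Real.cosh x, -Real.sinh x; Real.sinh x, -Real.cosh x]).toContinuousLinearMap).det| = 1 := by
    have h := Real.cosh_sq x
    simp only [LinearMap.det_toContinuousLinearMap, LinearMap.det_toLin, Matrix.det_fin_two_of]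
    rw [abs_eq zero_le_one]
    right
    linear_combination -h
  rw [hdet]
  simp only [Pi.mul_apply, lorentzReflection_quadratic, ENNReal.ofReal_one,
    one_mul]

/-! ### Hyperbolic polar coordinates. -/

lemma hasFDerivAt_hyperbolicPolar (p : ℝ × ℝ) :
    HasFDerivAt hyperbolicPolar
      (Matrix.toLin (.finTwoProd ℝ) (.finTwoProd ℝ)
        !![Real.sinh p.1, 0; Real.cosh p.1 * Real.cos p.2,
          -(Real.sinh p.1 * Real.sin p.2)]).toContinuousLinearMap p := by
  rw [Matrix.toLin_finTwoProd_toContinuousLinearMap]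
  convert!
    HasFDerivAt.prodMk (𝕜 := ℝ)
      ((Real.hasDerivAt_cosh p.1).comp_hasFDerivAt p hasFDerivAt_fst)
      (((Real.hasDerivAt_sinh p.1).comp_hasFDerivAt p hasFDerivAt_fst).mul
        ((Real.hasDerivAt_cos p.2).comp_hasFDerivAt p hasFDerivAt_snd)) using 2
  · simp
  · simp only [smul_smul, Function.comp_apply]
    rw [add_comm, mul_comm (Real.cosh p.1), mul_neg]

lemma injOn_hyperbolicPolar : InjOn hyperbolicPolar (Ioi 0 ×ˢ Ioo 0 Real.pi) := by
  rintro ⟨t, φ⟩ ⟨ht, hφ⟩ ⟨s, ψ⟩ ⟨hs, hψ⟩ h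
  simp only [hyperbolicPolar, Prod.mk.injEq] at h
  simp only [mem_Ioi] at ht hs
  have hts : t = s := Real.cosh_injOn ht.le hs.le h.1
  subst hts
  have hc := mul_left_cancel₀ (Real.sinh_pos_iff.2 ht).ne' h.2
  exact Prod.ext rfl (Real.injOn_cos (Ioo_subset_Icc_self hφ) (Ioo_subset_Icc_self hψ) hc)

lemma hyperbolicPolar_quadratic (p : ℝ × ℝ) :
    (hyperbolicPolar p).1 ^ 2 - 1 - (hyperbolicPolar p).2 ^ 2
      = (Real.sinh p.1 * Real.sin p.2) ^ 2 := by
  have h := Real.cosh_sq p.1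
  have h2 := Real.sin_sq_add_cos_sq p.2
  simp only [hyperbolicPolar]
  linear_combination h - Real.sinh p.1 ^ 2 * h2

lemma image_hyperbolicPolar :
    hyperbolicPolar '' (Ioi 0 ×ˢ Ioo 0 Real.pi) = hyperbolicRegion := by
  apply Subset.antisymm
  · rintro _ ⟨⟨t, φ⟩, ⟨ht, hφ⟩, rfl⟩
    simp only [mem_Ioi] at ht
    have hpos : 0 < Real.sinh t * Real.sin φ :=
      mul_pos (Real.sinh_pos_iff.2 ht) (Real.sin_pos_of_mem_Ioo hφ)
    have hQ := hyperbolicPolar_quadratic (t, φ)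
    refine ⟨?_, ?_⟩
    · exact Real.one_lt_cosh.2 ht.ne'
    · have := pow_pos hpos 2
      simp only at hQ
      linarith
  · rintro ⟨u, v⟩ ⟨h1, h2⟩
    simp only at h1 h2
    have hs : 0 < √(u ^ 2 - 1) := Real.sqrt_pos.2 (by nlinarith)
    have hsq : √(u ^ 2 - 1) ^ 2 = u ^ 2 - 1 := Real.sq_sqrt (by nlinarith)
    have habs : |v / √(u ^ 2 - 1)| < 1 := by
      rw [abs_div, abs_of_pos hs, div_lt_one hs]
      exact abs_lt_of_sq_lt_sq (by rwa [hsq]) hs.le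
    obtain ⟨ha, hb⟩ := abs_lt.1 habs
    refine ⟨(Real.arcosh u, Real.arccos (v / √(u ^ 2 - 1))),
      ⟨Real.arcosh_pos h1, Real.arccos_pos.2 hb, ?_⟩, ?_⟩
    · exact (Real.arccos_le_pi _).lt_of_ne fun h => by
        rw [Real.arccos_eq_pi] at h
        linarith
    · simp only [hyperbolicPolar, Real.cosh_arcosh h1.le, Real.sinh_arcosh h1.le,
        Real.cos_arccos ha.le hb.le]
      rw [mul_div_cancel₀ _ hs.ne']

lemma gegenbauerMeasure_eq_Ioi (lam : ℝ) :
    gegenbauerMeasure lam = (volume.restrict (Ioi 0)).withDensity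
      (fun t => ENNReal.ofReal (Real.sinh t ^ (2 * lam))) := by
  unfold gegenbauerMeasure
  rw [restrict_Ioi_eq_restrict_Ici]

lemma measurable_gegenbauerDensity (lam : ℝ) :
    Measurable (fun t : ℝ => ENNReal.ofReal (Real.sinh t ^ (2 * lam))) := by
  have := Real.measurable_sinh
  fun_prop

lemma measurable_gegenbauerAngleDensity (lam : ℝ) :
    Measurable (fun φ : ℝ => ENNReal.ofReal (Real.sin φ ^ (2 * lam - 1))) := by
  have := Real.measurable_sin
  fun_prop

instance (lam : ℝ) : SFinite (gegenbauerMeasure lam) := by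
  unfold gegenbauerMeasure; infer_instance

instance (lam : ℝ) : SFinite (gegenbauerAngleMeasure lam) := by
  unfold gegenbauerAngleMeasure; infer_instance

/-- The Jacobian is `sh² t sin φ` in absolute value and `u² - 1 - v² = (sh t sin φ)²`; the exponents
match as `2λ = 2 + 2(λ-1)` and `2λ - 1 = 1 + 2(λ-1)`. -/
theorem map_hyperbolicPolar (lam : ℝ) :
    ((gegenbauerMeasure lam).prod (gegenbauerAngleMeasure lam)).map hyperbolicPolar
      = lorentzMeasure lam := by
  refine Measure.ext_of_lintegral _ fun F hF => ?_
  have hP := continuous_hyperbolicPolar.measurable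
  have h1 := measurable_gegenbauerDensity lam
  have h2 := measurable_gegenbauerAngleDensity lam
  rw [lintegral_map hF hP]
  unfold lorentzMeasure
  rw [gegenbauerMeasure_eq_Ioi, gegenbauerAngleMeasure, prod_withDensity h1 h2,
    Measure.prod_restrict, ← Measure.volume_eq_prod,
    lintegral_withDensity_eq_lintegral_mul _
      (show Measurable fun z : ℝ × ℝ => ENNReal.ofReal (Real.sinh z.1 ^ (2 * lam))
        * ENNReal.ofReal (Real.sin z.2 ^ (2 * lam - 1)) from
        (h1.comp measurable_fst).mul (h2.comp measurable_snd))
      (show Measurable fun p => F (hyperbolicPolar p) from hF.comp hP),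
    lintegral_withDensity_eq_lintegral_mul _ (measurable_lorentzDensity lam) hF,
    ← image_hyperbolicPolar,
    lintegral_image_eq_lintegral_abs_det_fderiv_mul volume
      (measurableSet_Ioi.prod measurableSet_Ioo)
      (fun q _ => (hasFDerivAt_hyperbolicPolar q).hasFDerivWithinAt) injOn_hyperbolicPolar]
  refine setLIntegral_congr_fun (measurableSet_Ioi.prod measurableSet_Ioo) ?_
  rintro ⟨t, φ⟩ ⟨ht, hφ⟩
  have hs : 0 < Real.sinh t := Real.sinh_pos_iff.2 ht
  have hsin : 0 < Real.sin φ := Real.sin_pos_of_mem_Ioo hφ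
  simp only [Pi.mul_apply, hyperbolicPolar_quadratic]
  rw [← mul_assoc, ← ENNReal.ofReal_mul (by positivity), ← ENNReal.ofReal_mul (by positivity)]
  congr 2
  simp only [LinearMap.det_toContinuousLinearMap, LinearMap.det_toLin, Matrix.det_fin_two_of]
  rw [zero_mul, sub_zero, mul_neg, abs_neg, abs_of_pos (by positivity),
    ← Real.rpow_natCast _ 2, ← Real.rpow_mul (by positivity),
    Real.mul_rpow hs.le hsin.le]
  have e1 : Real.sinh t ^ (2 * lam)
      = Real.sinh t * Real.sinh t * Real.sinh t ^ (((2 : ℕ) : ℝ) * (lam - 1)) := by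
    rw [← pow_two, ← Real.rpow_natCast _ 2, ← Real.rpow_add hs]
    congr 1; push_cast; ring
  have e2 : Real.sin φ ^ (2 * lam - 1)
      = Real.sin φ * Real.sin φ ^ (((2 : ℕ) : ℝ) * (lam - 1)) := by
    nth_rw 2 [← Real.rpow_one (Real.sin φ)]
    rw [← Real.rpow_add hsin]
    congr 1; push_cast; ring
  rw [e1, e2]
  ring

/-- The hyperbolic law of cosines `ch x ch t - sh x sh t cos φ`. -/
noncomputable def coshLaw (x : ℝ) (p : ℝ × ℝ) : ℝ :=
  Real.cosh x * Real.cosh p.1 - Real.sinh x * Real.sinh p.1 * Real.cos p.2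

lemma continuous_coshLaw (x : ℝ) : Continuous (coshLaw x) := by
  unfold coshLaw
  have h1 := Real.continuous_cosh
  have h2 := Real.continuous_sinh
  fun_prop

/-- Exchange of the roles of the side `t` and of the side opposite to the angle `φ` in a
hyperbolic triangle with third side `x`. -/
theorem map_coshLaw_swap (lam x : ℝ) :
    ((gegenbauerMeasure lam).prod (gegenbauerAngleMeasure lam)).map
        (fun p => (coshLaw x p, Real.cosh p.1))
      = ((gegenbauerMeasure lam).prod (gegenbauerAngleMeasure lam)).map
        (fun p => (Real.cosh p.1, coshLaw x p)) := by
  have hP := continuous_hyperbolicPolar.measurable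
  have hL := (continuous_lorentzReflection x).measurable
  have hA : Measurable fun q : ℝ × ℝ => ((lorentzReflection x q).1, q.1) := by fun_prop
  have e1 : (fun p => (coshLaw x p, Real.cosh p.1))
      = (fun q : ℝ × ℝ => ((lorentzReflection x q).1, q.1)) ∘ hyperbolicPolar := by
    funext p
    simp [coshLaw, lorentzReflection, hyperbolicPolar, mul_assoc]
  have e2 : (fun p => (Real.cosh p.1, coshLaw x p))
      = (fun q : ℝ × ℝ => ((lorentzReflection x q).1, q.1)) ∘ lorentzReflection x
        ∘ hyperbolicPolar := by
    funext p
    simp only [Function.comp_apply, lorentzReflection_involutive x _]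
    simp [coshLaw, lorentzReflection, hyperbolicPolar, mul_assoc]
  rw [e1, e2, ← Measure.map_map hA hP, ← Measure.map_map hA (hL.comp hP),
    ← Measure.map_map hL hP, map_hyperbolicPolar, map_lorentzReflection]

/-! ### Total mass of the angular measure. -/

lemma image_half_one_sub_cos :
    (fun φ : ℝ => (1 - Real.cos φ) / 2) '' Ioo 0 Real.pi = Ioo 0 1 := by
  apply Subset.antisymm
  · rintro _ ⟨φ, hφ, rfl⟩
    have hs := Real.sin_pos_of_mem_Ioo hφ
    have h2 := Real.sin_sq_add_cos_sq φ
    constructor <;> dsimp only <;> nlinarith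
  · rintro y ⟨h0, h1⟩
    refine ⟨Real.arccos (1 - 2 * y), ⟨Real.arccos_pos.2 (by linarith), ?_⟩, ?_⟩
    · exact (Real.arccos_le_pi _).lt_of_ne fun h => by
        rw [Real.arccos_eq_pi] at h
        linarith
    · simp only
      rw [Real.cos_arccos (by linarith) (by linarith)]
      ring

/-- The substitution `y = (1 - cos φ)/2` turns the Beta(λ, λ) density into a multiple of `(sin
φ)^{2λ-1}`, because `y(1 - y) = (sin φ / 2)²`. Legendre's duplication formula gives the stated
constant. -/
theorem gegenbauerAngleMeasure_univ {lam : ℝ} (hlam : 0 < lam) :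
    gegenbauerAngleMeasure lam univ
      = ENNReal.ofReal (Real.Gamma (1 / 2) * Real.Gamma lam / Real.Gamma (lam + 1 / 2)) := by
  have hB := ProbabilityTheory.beta_pos hlam hlam
  have h1 := ProbabilityTheory.lintegral_betaPDF_eq_one hlam hlam
  rw [ProbabilityTheory.lintegral_betaPDF, ← image_half_one_sub_cos,
    lintegral_image_eq_lintegral_abs_deriv_mul (f' := fun φ => Real.sin φ / 2) measurableSet_Ioo
      (fun φ _ => by
        have := ((Real.hasDerivAt_cos φ).const_sub 1).div_const 2
        simpa using this.hasDerivWithinAt)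
      (fun φ hφ ψ hψ h => Real.injOn_cos (Ioo_subset_Icc_self hφ) (Ioo_subset_Icc_self hψ)
        (by linarith))] at h1
  have key : ∀ φ ∈ Ioo 0 Real.pi, ENNReal.ofReal |Real.sin φ / 2| *
      ENNReal.ofReal (1 / ProbabilityTheory.beta lam lam * ((1 - Real.cos φ) / 2) ^ (lam - 1) *
        (1 - (1 - Real.cos φ) / 2) ^ (lam - 1))
      = ENNReal.ofReal (1 / ProbabilityTheory.beta lam lam * 2 ^ (1 - 2 * lam)) *
        ENNReal.ofReal (Real.sin φ ^ (2 * lam - 1)) := by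
    intro φ hφ
    have hs := Real.sin_pos_of_mem_Ioo hφ
    have h2 := Real.sin_sq_add_cos_sq φ
    have ha : 0 < 1 - Real.cos φ := by nlinarith
    have hb : 0 < 1 + Real.cos φ := by nlinarith
    rw [← ENNReal.ofReal_mul (abs_nonneg _), ← ENNReal.ofReal_mul (by positivity),
      abs_of_pos (by positivity), mul_assoc (1 / _),
      ← Real.mul_rpow (by positivity) (by linarith),
      show (1 - Real.cos φ) / 2 * (1 - (1 - Real.cos φ) / 2) = (Real.sin φ / 2) ^ (2 : ℕ) by
        nlinarith, ← Real.rpow_natCast _ 2, ← Real.rpow_mul (by positivity)]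
    have e : Real.sin φ / 2 * (Real.sin φ / 2) ^ (((2 : ℕ) : ℝ) * (lam - 1))
        = 2 ^ (1 - 2 * lam) * Real.sin φ ^ (2 * lam - 1) := by
      nth_rw 1 [← Real.rpow_one (Real.sin φ / 2)]
      rw [← Real.rpow_add (by positivity), Real.div_rpow hs.le zero_le_two, div_eq_mul_inv,
        ← Real.rpow_neg zero_le_two, mul_comm]
      congr 2 <;> push_cast <;> ring
    congr 1
    linear_combination (1 / ProbabilityTheory.beta lam lam) * e
  rw [setLIntegral_congr_fun measurableSet_Ioo key,
    lintegral_const_mul _ (measurable_gegenbauerAngleDensity lam)] at h1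
  rw [gegenbauerAngleMeasure, withDensity_apply _ MeasurableSet.univ, Measure.restrict_univ,
    ENNReal.eq_inv_of_mul_eq_one_left ((mul_comm _ _).trans h1),
    ← ENNReal.ofReal_inv_of_pos (by positivity)]
  congr 1
  have hG := Real.Gamma_mul_Gamma_add_half lam
  have g1 := Real.Gamma_pos_of_pos hlam
  have g2 := Real.Gamma_pos_of_pos (show 0 < lam + 1 / 2 by positivity)
  have g3 := Real.Gamma_pos_of_pos (show 0 < 2 * lam by positivity)
  rw [Real.Gamma_one_half_eq, ProbabilityTheory.beta, ← two_mul]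
  have h2 : (0 : ℝ) < 2 ^ (1 - 2 * lam) := by positivity
  generalize Real.Gamma (lam + 1 / 2) = G at hG g2 ⊢
  field_simp
  linear_combination hG

lemma gegenbauerAngleMeasure_real_univ {lam : ℝ} (hlam : 0 < lam) :
    (gegenbauerAngleMeasure lam).real univ
      = Real.Gamma (1 / 2) * Real.Gamma lam / Real.Gamma (lam + 1 / 2) := by
  have g1 := Real.Gamma_pos_of_pos hlam
  have g2 := Real.Gamma_pos_of_pos (show 0 < lam + 1 / 2 by positivity)
  have g3 := Real.Gamma_pos_of_pos (show (0 : ℝ) < 1 / 2 by positivity)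
  rw [measureReal_def, gegenbauerAngleMeasure_univ hlam, ENNReal.toReal_ofReal (by positivity)]

lemma isFiniteMeasure_gegenbauerAngleMeasure {lam : ℝ} (hlam : 0 < lam) :
    IsFiniteMeasure (gegenbauerAngleMeasure lam) :=
  ⟨by rw [gegenbauerAngleMeasure_univ hlam]; exact ENNReal.ofReal_lt_top⟩

/-! ### Null sets and size estimates for the two measures. -/

lemma ae_gegenbauerAngleMeasure_mem (lam : ℝ) :
    ∀ᵐ φ ∂gegenbauerAngleMeasure lam, φ ∈ Ioo 0 Real.pi :=
  (withDensity_absolutelyContinuous _ _) (ae_restrict_mem measurableSet_Ioo)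

lemma ae_gegenbauerMeasure_pos (lam : ℝ) : ∀ᵐ t ∂gegenbauerMeasure lam, 0 < t := by
  rw [gegenbauerMeasure_eq_Ioi]
  exact (withDensity_absolutelyContinuous _ _) (ae_restrict_mem measurableSet_Ioi)

lemma restrict_Ici_absolutelyContinuous_gegenbauerMeasure (lam : ℝ) :
    volume.restrict (Ici 0) ≪ gegenbauerMeasure lam := by
  rw [gegenbauerMeasure_eq_Ioi, ← restrict_Ioi_eq_restrict_Ici]
  refine withDensity_absolutelyContinuous' (measurable_gegenbauerDensity lam).aemeasurable ?_
  filter_upwards [ae_restrict_mem measurableSet_Ioi] with t ht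
  have := Real.sinh_pos_iff.2 ht
  simp only [ne_eq, ENNReal.ofReal_eq_zero, not_le]
  positivity

lemma isLocallyFiniteMeasure_gegenbauerMeasure {lam : ℝ} (hlam : 0 < lam) :
    IsLocallyFiniteMeasure (gegenbauerMeasure lam) := by
  unfold gegenbauerMeasure
  refine IsLocallyFiniteMeasure.withDensity_ofReal ?_
  exact Real.continuous_sinh.rpow_const fun _ => Or.inr (by positivity)

/-- The measure of a cap is at most of the order `δ^{2λ}`. -/
lemma gegenbauerAngleMeasure_Iic_le {lam : ℝ} (hlam : 0 < lam) :
    ∃ K : ℝ, 0 ≤ K ∧ ∀ δ : ℝ, 0 ≤ δ → δ ≤ Real.pi / 2 →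
      (gegenbauerAngleMeasure lam).real (Iic δ) ≤ K * δ ^ (2 * lam) := by
  have hpi := Real.pi_pos
  obtain ⟨K, hK, hsin⟩ : ∃ K : ℝ, 0 ≤ K ∧ ∀ θ : ℝ, 0 < θ → θ ≤ Real.pi / 2 →
      Real.sin θ ^ (2 * lam - 1) ≤ K * θ ^ (2 * lam - 1) := by
    -- The sign of the exponent decides which bound on the sine is needed: `sin θ ≤ θ`, or Jordan's
    -- `sin θ ≥ 2θ/π`.
    rcases le_total 0 (2 * lam - 1) with h | h
    · refine ⟨1, zero_le_one, fun θ h0 h1 => ?_⟩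
      rw [one_mul]
      exact Real.rpow_le_rpow (Real.sin_nonneg_of_nonneg_of_le_pi h0.le (by linarith))
        (Real.sin_le h0.le) h
    · refine ⟨(2 / Real.pi) ^ (2 * lam - 1), by positivity, fun θ h0 h1 => ?_⟩
      rw [← Real.mul_rpow (by positivity) h0.le]
      exact Real.rpow_le_rpow_of_nonpos (by positivity) (Real.mul_le_sin h0.le h1) h
  refine ⟨K / (2 * lam), by positivity, fun δ h0 h1 => ?_⟩
  refine ENNReal.toReal_le_of_le_ofReal (by positivity) ?_
  rw [gegenbauerAngleMeasure, withDensity_apply _ measurableSet_Iic,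
    Measure.restrict_restrict measurableSet_Iic]
  have hint : IntervalIntegrable (fun θ : ℝ => K * θ ^ (2 * lam - 1)) volume 0 δ :=
    (intervalIntegral.intervalIntegrable_rpow' (by linarith)).const_mul K
  calc ∫⁻ θ in Iic δ ∩ Ioo 0 Real.pi, ENNReal.ofReal (Real.sin θ ^ (2 * lam - 1))
      ≤ ∫⁻ θ in Ioc 0 δ, ENNReal.ofReal (Real.sin θ ^ (2 * lam - 1)) :=
        lintegral_mono_set fun θ hθ => ⟨hθ.2.1, hθ.1⟩
    _ ≤ ∫⁻ θ in Ioc 0 δ, ENNReal.ofReal (K * θ ^ (2 * lam - 1)) :=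
        setLIntegral_mono' measurableSet_Ioc fun θ hθ =>
          ENNReal.ofReal_le_ofReal (hsin θ hθ.1 (hθ.2.trans h1))
    _ = ENNReal.ofReal (∫ θ in (0 : ℝ)..δ, K * θ ^ (2 * lam - 1)) := by
        rw [intervalIntegral.integral_of_le h0, ofReal_integral_eq_lintegral_ofReal]
        · exact (intervalIntegrable_iff_integrableOn_Ioc_of_le h0).1 hint
        · filter_upwards [ae_restrict_mem measurableSet_Ioc] with θ hθ
          have := hθ.1
          simp only [Pi.zero_apply]
          positivity
    _ ≤ ENNReal.ofReal (K / (2 * lam) * δ ^ (2 * lam)) := by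
        rw [intervalIntegral.integral_const_mul, integral_rpow (Or.inl (by linarith)),
          sub_add_cancel, Real.zero_rpow (by positivity), sub_zero]
        exact ENNReal.ofReal_le_ofReal (le_of_eq (by ring))

lemma gegenbauerH_zero (r : ℝ) : gegenbauerH 0 r = Ioo (-r) r ∩ Ici 0 := by
  simp [gegenbauerH]

lemma le_gegenbauerMeasure_gegenbauerH {lam r : ℝ} (hlam : 0 < lam) (hr : 0 < r) :
    r ^ (2 * lam + 1) / (2 * lam + 1) ≤ (gegenbauerMeasure lam).real (gegenbauerH 0 r) := by
  have := isLocallyFiniteMeasure_gegenbauerMeasure hlam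
  have hfin : gegenbauerMeasure lam (gegenbauerH 0 r) ≠ ∞ := by
    rw [gegenbauerH_zero]
    exact ((measure_mono (inter_subset_left.trans Ioo_subset_Icc_self)).trans_lt
      isCompact_Icc.measure_lt_top).ne
  rw [measureReal_def, ← ENNReal.ofReal_le_iff_le_toReal hfin, gegenbauerMeasure,
    gegenbauerH_zero,
    withDensity_apply _ (measurableSet_Ioo.inter measurableSet_Ici),
    Measure.restrict_restrict (measurableSet_Ioo.inter measurableSet_Ici)]
  have hint : IntervalIntegrable (fun t : ℝ => t ^ (2 * lam)) volume 0 r :=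
    intervalIntegral.intervalIntegrable_rpow' (by linarith)
  calc ENNReal.ofReal (r ^ (2 * lam + 1) / (2 * lam + 1))
      = ENNReal.ofReal (∫ t in (0 : ℝ)..r, t ^ (2 * lam)) := by
        rw [integral_rpow (Or.inl (by linarith)), Real.zero_rpow (by positivity), sub_zero]
    _ = ∫⁻ t in Ioo 0 r, ENNReal.ofReal (t ^ (2 * lam)) := by
        rw [intervalIntegral.integral_of_le hr.le, ofReal_integral_eq_lintegral_ofReal,
          restrict_Ioo_eq_restrict_Ioc]
        · exact (intervalIntegrable_iff_integrableOn_Ioc_of_le hr.le).1 hint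
        · filter_upwards [ae_restrict_mem measurableSet_Ioc] with θ hθ
          have := hθ.1
          simp only [Pi.zero_apply]
          positivity
    _ ≤ ∫⁻ t in Ioo 0 r, ENNReal.ofReal (Real.sinh t ^ (2 * lam)) :=
        setLIntegral_mono' measurableSet_Ioo fun t ht => ENNReal.ofReal_le_ofReal
          (Real.rpow_le_rpow ht.1.le (Real.self_le_sinh_iff.2 ht.1.le) (by positivity))
    _ ≤ ∫⁻ t in Ioo (-r) r ∩ Ici 0 ∩ Ici 0, ENNReal.ofReal (Real.sinh t ^ (2 * lam)) :=
        lintegral_mono_set fun t ht =>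
          ⟨⟨⟨by linarith [ht.1], ht.2⟩, ht.1.le⟩, ht.1.le⟩

lemma gegenbauerMeasure_closedBall_le {lam x r : ℝ} (hlam : 0 < lam) (hr : 0 ≤ r)
    (hxr : 0 ≤ x + r) :
    (gegenbauerMeasure lam).real (Metric.closedBall x r)
      ≤ Real.sinh (x + r) ^ (2 * lam) * (2 * r) := by
  have hs := Real.sinh_nonneg_iff.2 hxr
  refine ENNReal.toReal_le_of_le_ofReal (by positivity) ?_
  rw [gegenbauerMeasure, withDensity_apply _ Metric.isClosed_closedBall.measurableSet,
    Measure.restrict_restrict Metric.isClosed_closedBall.measurableSet, Real.closedBall_eq_Icc]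
  calc ∫⁻ t in Icc (x - r) (x + r) ∩ Ici 0, ENNReal.ofReal (Real.sinh t ^ (2 * lam))
      ≤ ∫⁻ _ in Icc (x - r) (x + r) ∩ Ici 0,
          ENNReal.ofReal (Real.sinh (x + r) ^ (2 * lam)) :=
        setLIntegral_mono' (measurableSet_Icc.inter measurableSet_Ici) fun t ht =>
          ENNReal.ofReal_le_ofReal (Real.rpow_le_rpow (Real.sinh_nonneg_iff.2 ht.2)
            (Real.sinh_le_sinh.2 ht.1.2) (by positivity))
    _ ≤ ENNReal.ofReal (Real.sinh (x + r) ^ (2 * lam)) * volume (Icc (x - r) (x + r)) := by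
        rw [setLIntegral_const]
        gcongr
        exact inter_subset_left
    _ = _ := by
        rw [Real.volume_Icc, ← ENNReal.ofReal_mul (by positivity)]
        congr 2
        ring

/-- This is the triangle inequality; it localizes the kernel to `|x - z| < r`. -/
lemma cosh_sub_le_coshLaw {x : ℝ} (hx : 0 ≤ x) {p : ℝ × ℝ} (hp : 0 ≤ p.1) :
    Real.cosh (x - p.1) ≤ coshLaw x p := by
  rw [Real.cosh_sub, coshLaw]
  have := mul_nonneg (Real.sinh_nonneg_iff.2 hx) (Real.sinh_nonneg_iff.2 hp)
  nlinarith [Real.cos_le_one p.2]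

lemma abs_sub_lt_of_coshLaw_lt {x r : ℝ} (hx : 0 ≤ x) (hr : 0 < r) {p : ℝ × ℝ} (hp : 0 ≤ p.1)
    (h : coshLaw x p < Real.cosh r) : |x - p.1| < r := by
  have := Real.cosh_lt_cosh.1 ((cosh_sub_le_coshLaw hx hp).trans_lt h)
  rwa [abs_of_pos hr] at this

/-- The hyperbolic ball of small radius `r` is seen under an angular measure `O(r^{2λ})`. -/
lemma gegenbauerAngleMeasure_coshLaw_lt {lam x : ℝ} (hlam : 0 < lam) (hx : 0 < x) :
    ∃ C : ℝ, 0 ≤ C ∧ ∀ᶠ r in 𝓝[>] (0 : ℝ), ∀ z ∈ Metric.closedBall x r,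
      (gegenbauerAngleMeasure lam).real {θ | coshLaw x (z, θ) < Real.cosh r}
        ≤ C * r ^ (2 * lam) := by
  have := isFiniteMeasure_gegenbauerAngleMeasure hlam
  obtain ⟨K, hK, hcap⟩ := gegenbauerAngleMeasure_Iic_le hlam
  have hpi := Real.pi_pos
  set s := Real.sinh x * Real.sinh (x / 2) with hs_def
  have hs : 0 < s := mul_pos (Real.sinh_pos_iff.2 hx) (Real.sinh_pos_iff.2 (by positivity))
  -- From `s(1 - cos θ) ≤ ch r - 1 ≤ r²` and `1 - cos θ ≥ 2θ²/π²` follows `θ ≤ B r`.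
  set B := Real.pi / √(2 * s) with hB_def
  have hB : 0 < B := by positivity
  have hB2 : B ^ 2 * (2 * s) = Real.pi ^ 2 := by
    rw [hB_def, div_pow, Real.sq_sqrt (by positivity)]
    field_simp
  refine ⟨K * B ^ (2 * lam), by positivity, ?_⟩
  -- The three bounds give, in order, `z ≥ x/2`, `ch r - 1 ≤ r²`, and `B r ≤ π/2` as the cap
  -- estimate requires.
  have e1 : ∀ᶠ r in 𝓝[>] (0 : ℝ), r < min (x / 2) (min 1 (Real.pi / 2 / B)) :=
    (eventually_lt_nhds (by positivity)).filter_mono nhdsWithin_le_nhds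
  filter_upwards [e1, self_mem_nhdsWithin] with r hr hr0 z hz
  simp only [mem_Ioi] at hr0
  simp only [lt_min_iff] at hr
  obtain ⟨hrx, hr1, hrB⟩ := hr
  rw [lt_div_iff₀ hB] at hrB
  rw [Real.closedBall_eq_Icc] at hz
  rw [mul_assoc, ← Real.mul_rpow hB.le hr0.le]
  refine le_trans ?_ (hcap (B * r) (by positivity) (by linarith))
  refine ENNReal.toReal_mono (measure_ne_top _ _) (measure_mono_ae ?_)
  filter_upwards [ae_gegenbauerAngleMeasure_mem lam] with θ hθ hlt
  have hlt : coshLaw x (z, θ) < Real.cosh r := hlt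
  show θ ≤ B * r
  have hcos := Real.cos_le_one_sub_mul_cos_sq (x := θ) (by rw [abs_of_pos hθ.1]; exact hθ.2.le)
  have hz2 : Real.sinh (x / 2) ≤ Real.sinh z := Real.sinh_le_sinh.2 (by linarith [hz.1])
  have hss : s ≤ Real.sinh x * Real.sinh z :=
    mul_le_mul_of_nonneg_left hz2 (Real.sinh_pos_iff.2 hx).le
  have hch : Real.cosh r - 1 ≤ r ^ 2 := by
    have h1 := Real.cosh_le_exp_half_sq r
    have h2 := Real.abs_exp_sub_one_le (x := r ^ 2 / 2) (by
      rw [abs_of_nonneg (by positivity)]; nlinarith)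
    rw [abs_of_nonneg (a := r ^ 2 / 2) (by positivity)] at h2
    linarith [le_abs_self (Real.exp (r ^ 2 / 2) - 1)]
  have hone := Real.one_le_cosh (x - z)
  have hlaw : coshLaw x (z, θ)
      = Real.cosh (x - z) + Real.sinh x * Real.sinh z * (1 - Real.cos θ) := by
    rw [Real.cosh_sub, coshLaw]; ring
  have h3 : s * (1 - Real.cos θ) ≤ r ^ 2 :=
    (mul_le_mul_of_nonneg_right hss (by linarith [Real.cos_le_one θ])).trans (by linarith)
  have h4 : s * (2 / Real.pi ^ 2 * θ ^ 2) ≤ r ^ 2 :=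
    (mul_le_mul_of_nonneg_left (by linarith) hs.le).trans h3
  have h5 : θ ^ 2 ≤ (B * r) ^ 2 := by
    have : s * (2 / Real.pi ^ 2 * θ ^ 2) = θ ^ 2 / B ^ 2 := by
      rw [← hB2]; field_simp
    rw [this, div_le_iff₀ (by positivity)] at h4
    linarith
  exact le_of_sq_le_sq h5 (by positivity)

/-! ### Measurability and integrability of the truncation, and the exchange of sides. -/

lemma aestronglyMeasurable_map_cosh {E : Type*} [TopologicalSpace E] {lam : ℝ} {f : ℝ → E}
    (hf : AEStronglyMeasurable (fun t => f (Real.cosh t)) (gegenbauerMeasure lam)) :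
    AEStronglyMeasurable f ((gegenbauerMeasure lam).map Real.cosh) := by
  have hcosh := Real.measurable_cosh
  have hge : ∀ᵐ u ∂(gegenbauerMeasure lam).map Real.cosh, 1 ≤ u :=
    (ae_map_iff hcosh.aemeasurable measurableSet_Ici).2 (ae_of_all _ Real.one_le_cosh)
  have harc : Measurable Real.arcosh := by unfold Real.arcosh; fun_prop
  have hmap : ((gegenbauerMeasure lam).map Real.cosh).map Real.arcosh
      = gegenbauerMeasure lam := by
    rw [Measure.map_map harc hcosh]
    conv_rhs => rw [← Measure.map_id (μ := gegenbauerMeasure lam)]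
    refine Measure.map_congr ?_
    filter_upwards [ae_gegenbauerMeasure_pos lam] with t ht
    exact Real.arcosh_cosh ht.le
  rw [← hmap] at hf
  refine (hf.comp_measurable harc).congr ?_
  filter_upwards [hge] with u hu
  simp only [Function.comp_apply, Real.cosh_arcosh hu]

/-- The truncation to a hyperbolic ball, seen as a function of the two sides of a triangle. -/
noncomputable def sideTruncation {E : Type*} [Zero E] (r : ℝ) (f : ℝ → E) (q : ℝ × ℝ) : E :=
  (Iio (Real.cosh r)).indicator (fun _ => f q.1) q.2

/-- The first marginal of the joint law is a multiple of the law of `ch t`. The exchange of sides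
then also makes `f(coshLaw)` measurable, which is not clear directly for an a.e. class. -/
lemma aestronglyMeasurable_sideTruncation {E : Type*} [TopologicalSpace E] [Zero E] {lam : ℝ}
    {f : ℝ → E} (x r : ℝ)
    (hf : AEStronglyMeasurable (fun t => f (Real.cosh t)) (gegenbauerMeasure lam)) :
    AEStronglyMeasurable (sideTruncation r f)
      (((gegenbauerMeasure lam).prod (gegenbauerAngleMeasure lam)).map
        (fun p => (Real.cosh p.1, coshLaw x p))) := by
  have hΦ : Measurable fun p : ℝ × ℝ => (Real.cosh p.1, coshLaw x p) :=
    (Real.measurable_cosh.comp measurable_fst).prodMk (continuous_coshLaw x).measurable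
  have h1 : AEStronglyMeasurable f ((((gegenbauerMeasure lam).prod
      (gegenbauerAngleMeasure lam)).map (fun p => (Real.cosh p.1, coshLaw x p))).map
        Prod.fst) := by
    rw [Measure.map_map measurable_fst hΦ]
    have : (Prod.fst ∘ fun p : ℝ × ℝ => (Real.cosh p.1, coshLaw x p))
        = Real.cosh ∘ Prod.fst := rfl
    rw [this, ← Measure.map_map Real.measurable_cosh measurable_fst, Measure.map_fst_prod]
    exact (aestronglyMeasurable_map_cosh hf).mono_ac
      (Measure.AbsolutelyContinuous.map Measure.smul_absolutelyContinuous Real.measurable_cosh)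
  exact (h1.comp_measurable measurable_fst).indicator
    (measurable_snd (measurableSet_Iio (a := Real.cosh r)))

section Swap

variable {E : Type*} [NormedAddCommGroup E]

/-- In this order of the sides the truncation confines `z` to a compact ball, so local integrability
and the finite angular mass suffice. -/
lemma integrable_sideTruncation {lam : ℝ} (hlam : 0 < lam) {f : ℝ → E}
    (hf : LocallyIntegrable (fun t => f (Real.cosh t)) (gegenbauerMeasure lam))
    {x r : ℝ} (hx : 0 ≤ x) (hr : 0 < r) :
    Integrable (fun p => sideTruncation r f (Real.cosh p.1, coshLaw x p))
      ((gegenbauerMeasure lam).prod (gegenbauerAngleMeasure lam)) := by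
  have := isFiniteMeasure_gegenbauerAngleMeasure hlam
  have hΦ : Measurable fun p : ℝ × ℝ => (Real.cosh p.1, coshLaw x p) :=
    (Real.measurable_cosh.comp measurable_fst).prodMk (continuous_coshLaw x).measurable
  have hloc : Integrable ((Metric.closedBall x r).indicator fun t => f (Real.cosh t))
      (gegenbauerMeasure lam) :=
    (hf.integrableOn_isCompact (isCompact_closedBall x r)).integrable_indicator
      Metric.isClosed_closedBall.measurableSet
  refine (hloc.norm.comp_fst (gegenbauerAngleMeasure lam)).mono'
    ((aestronglyMeasurable_sideTruncation x r hf.aestronglyMeasurable).comp_measurable hΦ) ?_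
  have hpos : ∀ᵐ p ∂(gegenbauerMeasure lam).prod (gegenbauerAngleMeasure lam), 0 < p.1 :=
    Measure.quasiMeasurePreserving_fst.ae (ae_gegenbauerMeasure_pos lam)
  filter_upwards [hpos] with p hp
  unfold sideTruncation
  by_cases h : coshLaw x p ∈ Iio (Real.cosh r)
  · have hmem : p.1 ∈ Metric.closedBall x r := by
      rw [Metric.mem_closedBall, dist_comm, Real.dist_eq]
      exact (abs_sub_lt_of_coshLaw_lt hx hr hp.le h).le
    rw [indicator_of_mem h, indicator_of_mem hmem]
  · rw [indicator_of_notMem h, norm_zero]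
    positivity

lemma integrable_sideTruncation_swap {lam : ℝ} (hlam : 0 < lam) {f : ℝ → E}
    (hf : LocallyIntegrable (fun t => f (Real.cosh t)) (gegenbauerMeasure lam))
    {x r : ℝ} (hx : 0 ≤ x) (hr : 0 < r) :
    Integrable (fun p => sideTruncation r f (coshLaw x p, Real.cosh p.1))
      ((gegenbauerMeasure lam).prod (gegenbauerAngleMeasure lam)) := by
  have hΦ : Measurable fun p : ℝ × ℝ => (Real.cosh p.1, coshLaw x p) :=
    (Real.measurable_cosh.comp measurable_fst).prodMk (continuous_coshLaw x).measurable
  have hΨ : Measurable fun p : ℝ × ℝ => (coshLaw x p, Real.cosh p.1) :=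
    (continuous_coshLaw x).measurable.prodMk (Real.measurable_cosh.comp measurable_fst)
  have hm := aestronglyMeasurable_sideTruncation x r hf.aestronglyMeasurable
  have h1 := (integrable_map_measure hm hΦ.aemeasurable).2
    (integrable_sideTruncation hlam hf hx hr)
  rw [← map_coshLaw_swap] at h1 hm
  exact (integrable_map_measure hm hΨ.aemeasurable).1 h1

lemma integral_sideTruncation_swap [NormedSpace ℝ E] {lam : ℝ} {f : ℝ → E}
    (hf : AEStronglyMeasurable (fun t => f (Real.cosh t)) (gegenbauerMeasure lam)) (x r : ℝ) :
    ∫ p, sideTruncation r f (coshLaw x p, Real.cosh p.1)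
        ∂(gegenbauerMeasure lam).prod (gegenbauerAngleMeasure lam)
      = ∫ p, sideTruncation r f (Real.cosh p.1, coshLaw x p)
        ∂(gegenbauerMeasure lam).prod (gegenbauerAngleMeasure lam) := by
  have hΦ : Measurable fun p : ℝ × ℝ => (Real.cosh p.1, coshLaw x p) :=
    (Real.measurable_cosh.comp measurable_fst).prodMk (continuous_coshLaw x).measurable
  have hΨ : Measurable fun p : ℝ × ℝ => (coshLaw x p, Real.cosh p.1) :=
    (continuous_coshLaw x).measurable.prodMk (Real.measurable_cosh.comp measurable_fst)
  have hm := aestronglyMeasurable_sideTruncation x r hf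
  rw [← integral_map (f := sideTruncation r f) hΦ.aemeasurable hm, ← map_coshLaw_swap,
    integral_map hΨ.aemeasurable (by rwa [map_coshLaw_swap])]

end Swap

/-! ### The shift as an angular integral, and its averages. -/

section Shift

variable {𝕜 : Type*} [RCLike 𝕜]

lemma integrable_gegenbauerAngleMeasure_iff (lam : ℝ) (f : ℝ → 𝕜) (t x : ℝ) :
    Integrable (fun φ => f (coshLaw x (t, φ))) (gegenbauerAngleMeasure lam)
      ↔ IntervalIntegrable (gegenbauerShiftIntegrand lam f t x) volume 0 Real.pi := by
  rw [intervalIntegrable_iff_integrableOn_Ioo_of_le Real.pi_pos.le, gegenbauerAngleMeasure,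
    integrable_withDensity_iff_integrable_smul' (measurable_gegenbauerAngleDensity lam)
      (ae_of_all _ fun _ => ENNReal.ofReal_lt_top)]
  refine integrable_congr ?_
  filter_upwards [ae_restrict_mem measurableSet_Ioo] with φ hφ
  have := Real.sin_pos_of_mem_Ioo hφ
  rw [ENNReal.toReal_ofReal (by positivity)]
  rfl

lemma gegenbauerShift_eq (lam : ℝ) (f : ℝ → 𝕜) (t x : ℝ) :
    gegenbauerShift lam f t x
      = (Real.Gamma (lam + 1 / 2) / (Real.Gamma (1 / 2) * Real.Gamma lam)) •
        ∫ φ, f (coshLaw x (t, φ)) ∂gegenbauerAngleMeasure lam := by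
  rw [gegenbauerShift, intervalIntegral.integral_of_le Real.pi_pos.le,
    integral_Ioc_eq_integral_Ioo, gegenbauerAngleMeasure,
    integral_withDensity_eq_integral_toReal_smul (measurable_gegenbauerAngleDensity lam)
      (ae_of_all _ fun _ => ENNReal.ofReal_lt_top)]
  congr 1
  refine setIntegral_congr_fun measurableSet_Ioo fun φ hφ => ?_
  have := Real.sin_pos_of_mem_Ioo hφ
  rw [ENNReal.toReal_ofReal (by positivity)]
  rfl

lemma gegenbauerShift_const {lam : ℝ} (hlam : 0 < lam) (k : 𝕜) (t x : ℝ) :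
    gegenbauerShift lam (fun _ => k) t x = k := by
  rw [gegenbauerShift_eq, integral_const, gegenbauerAngleMeasure_real_univ hlam, smul_smul]
  have g1 := Real.Gamma_pos_of_pos hlam
  have g2 := Real.Gamma_pos_of_pos (show 0 < lam + 1 / 2 by positivity)
  have g3 := Real.Gamma_pos_of_pos (show (0 : ℝ) < 1 / 2 by positivity)
  convert one_smul ℝ k
  generalize Real.Gamma (lam + 1 / 2) = G at g2 ⊢
  field_simp

lemma measurableSet_gegenbauerH (x r : ℝ) : MeasurableSet (gegenbauerH x r) :=
  measurableSet_Ioo.inter measurableSet_Ici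

lemma cosh_lt_cosh_iff_mem_gegenbauerH {t r : ℝ} (ht : 0 ≤ t) (hr : 0 < r) :
    Real.cosh t < Real.cosh r ↔ t ∈ gegenbauerH 0 r := by
  rw [gegenbauerH_zero, Real.cosh_lt_cosh, abs_of_pos hr, abs_of_nonneg ht]
  exact ⟨fun h => ⟨⟨by linarith, h⟩, ht⟩, fun h => h.1.2⟩

lemma indicator_gegenbauerShift_ae_eq (lam : ℝ) (f : ℝ → 𝕜) (x : ℝ) {r : ℝ} (hr : 0 < r) :
    (gegenbauerH 0 r).indicator (fun t => gegenbauerShift lam f t x)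
      =ᵐ[gegenbauerMeasure lam] fun t =>
        (Real.Gamma (lam + 1 / 2) / (Real.Gamma (1 / 2) * Real.Gamma lam)) •
          ∫ φ, sideTruncation r f (coshLaw x (t, φ), Real.cosh t) ∂gegenbauerAngleMeasure lam := by
  filter_upwards [ae_gegenbauerMeasure_pos lam] with t ht
  have hiff := cosh_lt_cosh_iff_mem_gegenbauerH ht.le hr
  unfold sideTruncation
  by_cases h : t ∈ gegenbauerH 0 r
  · have h' : Real.cosh t ∈ Iio (Real.cosh r) := hiff.2 h
    simp only [indicator_of_mem h, indicator_of_mem h']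
    exact gegenbauerShift_eq lam f t x
  · have h' : Real.cosh t ∉ Iio (Real.cosh r) := fun h'' => h (hiff.1 h'')
    simp only [indicator_of_notMem h, indicator_of_notMem h', integral_zero, smul_zero]

variable {lam : ℝ} {f : ℝ → 𝕜}

lemma integrableOn_gegenbauerShift (hlam : 0 < lam)
    (hf : LocallyIntegrable (fun t => f (Real.cosh t)) (gegenbauerMeasure lam))
    {x r : ℝ} (hx : 0 ≤ x) (hr : 0 < r) :
    IntegrableOn (fun t => gegenbauerShift lam f t x) (gegenbauerH 0 r)
      (gegenbauerMeasure lam) := by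
  rw [← integrable_indicator_iff (measurableSet_gegenbauerH 0 r),
    integrable_congr (indicator_gegenbauerShift_ae_eq lam f x hr)]
  have hint := (integrable_sideTruncation_swap hlam hf hx hr).integral_prod_left
  exact hint.smul (Real.Gamma (lam + 1 / 2) / (Real.Gamma (1 / 2) * Real.Gamma lam))

lemma setIntegral_gegenbauerShift (hlam : 0 < lam)
    (hf : LocallyIntegrable (fun t => f (Real.cosh t)) (gegenbauerMeasure lam))
    {x r : ℝ} (hx : 0 ≤ x) (hr : 0 < r) :
    ∫ t in gegenbauerH 0 r, gegenbauerShift lam f t x ∂gegenbauerMeasure lam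
      = (Real.Gamma (lam + 1 / 2) / (Real.Gamma (1 / 2) * Real.Gamma lam)) •
        ∫ p, sideTruncation r f (Real.cosh p.1, coshLaw x p)
          ∂(gegenbauerMeasure lam).prod (gegenbauerAngleMeasure lam) := by
  rw [← integral_indicator (measurableSet_gegenbauerH 0 r),
    integral_congr_ae (indicator_gegenbauerShift_ae_eq lam f x hr), integral_smul,
    ← integral_sideTruncation_swap hf.aestronglyMeasurable x r,
    integral_prod _ (integrable_sideTruncation_swap hlam hf hx hr)]

lemma ae_intervalIntegrable_gegenbauerShiftIntegrand (hlam : 0 < lam)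
    (hf : LocallyIntegrable (fun t => f (Real.cosh t)) (gegenbauerMeasure lam))
    {x : ℝ} (hx : 0 ≤ x) :
    ∀ᵐ t ∂gegenbauerMeasure lam,
      IntervalIntegrable (gegenbauerShiftIntegrand lam f t x) volume 0 Real.pi := by
  have hall : ∀ n : ℕ, ∀ᵐ t ∂gegenbauerMeasure lam, Integrable
      (fun φ => sideTruncation (n + 1) f (coshLaw x (t, φ), Real.cosh t))
      -- The balls of radius `n + 1` exhaust the half-line, and `+ 1` keeps every radius positive.
      (gegenbauerAngleMeasure lam) := fun n =>
    (integrable_sideTruncation_swap hlam hf hx (by positivity)).prod_right_ae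
  filter_upwards [ae_all_iff.2 hall, ae_gegenbauerMeasure_pos lam] with t ht hpos
  obtain ⟨n, hn⟩ := exists_nat_gt t
  have h' : Real.cosh t ∈ Iio (Real.cosh (n + 1)) := by
    rw [mem_Iio, Real.cosh_lt_cosh, abs_of_pos hpos, abs_of_pos (by positivity)]
    linarith
  have := ht n
  simp only [sideTruncation, indicator_of_mem h'] at this
  exact (integrable_gegenbauerAngleMeasure_iff lam f t x).1 this

/-- The deviation of the averages of the shift is controlled by the mean oscillation. -/
lemma norm_setIntegral_gegenbauerShift_sub_le (hlam : 0 < lam)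
    (hf : LocallyIntegrable (fun t => f (Real.cosh t)) (gegenbauerMeasure lam))
    {x r : ℝ} (hx : 0 ≤ x) (hr : 0 < r) (k : 𝕜) {D : ℝ}
    (hD : ∀ z ∈ Metric.closedBall x r,
      (gegenbauerAngleMeasure lam).real {θ | coshLaw x (z, θ) < Real.cosh r} ≤ D) :
    ‖(∫ t in gegenbauerH 0 r, gegenbauerShift lam f t x ∂gegenbauerMeasure lam)
        - (gegenbauerMeasure lam).real (gegenbauerH 0 r) • k‖
      ≤ (Real.Gamma (lam + 1 / 2) / (Real.Gamma (1 / 2) * Real.Gamma lam)) *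
        (D * ∫ z in Metric.closedBall x r, ‖f (Real.cosh z) - k‖ ∂gegenbauerMeasure lam) := by
  have := isLocallyFiniteMeasure_gegenbauerMeasure hlam
  have := isFiniteMeasure_gegenbauerAngleMeasure hlam
  have g1 := Real.Gamma_pos_of_pos hlam
  have g2 := Real.Gamma_pos_of_pos (show 0 < lam + 1 / 2 by positivity)
  have g3 := Real.Gamma_pos_of_pos (show (0 : ℝ) < 1 / 2 by positivity)
  have hk : LocallyIntegrable (fun t => (fun _ : ℝ => k) (Real.cosh t)) (gegenbauerMeasure lam) :=
    locallyIntegrable_const k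
  have hfk : LocallyIntegrable (fun t => (fun u => f u - k) (Real.cosh t))
      (gegenbauerMeasure lam) := hf.sub hk
  -- Since the shift fixes constants, `|H(0, r)|_λ k` is an integral against the same kernel and can
  -- be subtracted under the integral sign.
  have hconst := setIntegral_gegenbauerShift (f := fun _ => k) hlam hk hx hr
  simp only [gegenbauerShift_const hlam] at hconst
  rw [setIntegral_const] at hconst
  rw [hconst, setIntegral_gegenbauerShift hlam hf hx hr, ← smul_sub,
    ← integral_sub (integrable_sideTruncation hlam hf hx hr)
      (integrable_sideTruncation (f := fun _ => k) hlam hk hx hr), norm_smul, Real.norm_of_nonneg (by positivity)]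
  refine mul_le_mul_of_nonneg_left ?_ (by positivity)
  have hint := (integrable_sideTruncation (f := fun u => f u - k) hlam hfk hx hr).norm
  have hsub : ∀ p : ℝ × ℝ, sideTruncation r f (Real.cosh p.1, coshLaw x p)
      - sideTruncation r (fun _ => k) (Real.cosh p.1, coshLaw x p)
      = sideTruncation r (fun u => f u - k) (Real.cosh p.1, coshLaw x p) := by
    intro p
    unfold sideTruncation
    by_cases h : coshLaw x p ∈ Iio (Real.cosh r)
    · simp only [indicator_of_mem h]
    · simp only [indicator_of_notMem h, sub_zero]
  simp only [hsub]
  refine (norm_integral_le_integral_norm _).trans ?_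
  rw [integral_prod _ hint, ← integral_const_mul,
    ← integral_indicator Metric.isClosed_closedBall.measurableSet]
  refine integral_mono_ae hint.integral_prod_left
    ((integrable_indicator_iff Metric.isClosed_closedBall.measurableSet).2
      ((hfk.integrableOn_isCompact (isCompact_closedBall x r)).norm.const_mul D)) ?_
  filter_upwards [ae_gegenbauerMeasure_pos lam] with z hz
  have hset : MeasurableSet {θ | coshLaw x (z, θ) < Real.cosh r} :=
    (isOpen_lt ((continuous_coshLaw x).comp (by fun_prop)) continuous_const).measurableSet
  have hfun : (fun θ => ‖sideTruncation r (fun u => f u - k) (Real.cosh z, coshLaw x (z, θ))‖)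
      = {θ | coshLaw x (z, θ) < Real.cosh r}.indicator fun _ => ‖f (Real.cosh z) - k‖ := by
    funext θ
    unfold sideTruncation
    by_cases h : coshLaw x (z, θ) < Real.cosh r
    · rw [indicator_of_mem (show coshLaw x (z, θ) ∈ Iio (Real.cosh r) from h),
        indicator_of_mem (show θ ∈ {θ | coshLaw x (z, θ) < Real.cosh r} from h)]
    · rw [indicator_of_notMem (show coshLaw x (z, θ) ∉ Iio (Real.cosh r) from h),
        indicator_of_notMem (show θ ∉ {θ | coshLaw x (z, θ) < Real.cosh r} from h), norm_zero]
  simp only [hfun]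
  rw [integral_indicator hset, setIntegral_const, smul_eq_mul]
  by_cases hzb : z ∈ Metric.closedBall x r
  · rw [indicator_of_mem hzb]
    exact mul_le_mul_of_nonneg_right (hD z hzb) (norm_nonneg _)
  · rw [indicator_of_notMem hzb]
    have hempty : {θ | coshLaw x (z, θ) < Real.cosh r} = ∅ := by
      refine eq_empty_of_forall_notMem fun θ h => hzb ?_
      rw [Metric.mem_closedBall, dist_comm, Real.dist_eq]
      exact (abs_sub_lt_of_coshLaw_lt hx hr (p := (z, θ)) hz.le h).le
    simp [hempty]

theorem tendsto_average_gegenbauerShift (hlam : 0 < lam)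
    (hf : LocallyIntegrable (fun t => f (Real.cosh t)) (gegenbauerMeasure lam))
    {x : ℝ} (hx : 0 < x)
    (hleb : Tendsto (fun r : ℝ => ⨍ z in Metric.closedBall x r,
      ‖f (Real.cosh z) - f (Real.cosh x)‖ ∂gegenbauerMeasure lam) (𝓝[>] 0) (𝓝 0)) :
    Tendsto
      (fun r : ℝ => ((gegenbauerMeasure lam).real (gegenbauerH 0 r))⁻¹ •
        ∫ t in gegenbauerH 0 r, gegenbauerShift lam f t x ∂(gegenbauerMeasure lam))
      (𝓝[>] 0) (𝓝 (f (Real.cosh x))) := by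
  have := isLocallyFiniteMeasure_gegenbauerMeasure hlam
  obtain ⟨C, hC, hcap⟩ := gegenbauerAngleMeasure_coshLaw_lt hlam hx
  set c := Real.Gamma (lam + 1 / 2) / (Real.Gamma (1 / 2) * Real.Gamma lam) with hc_def
  have hc : 0 < c := div_pos (Real.Gamma_pos_of_pos (by positivity))
    (mul_pos (Real.Gamma_pos_of_pos (by positivity)) (Real.Gamma_pos_of_pos hlam))
  have hS : 0 < Real.sinh (x + x) := Real.sinh_pos_iff.2 (by positivity)
  rw [tendsto_iff_norm_sub_tendsto_zero]
  have hlim := hleb.const_mul (c * C * (2 * lam + 1) * (Real.sinh (x + x) ^ (2 * lam) * 2))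
  rw [mul_zero] at hlim
  refine squeeze_zero' (Eventually.of_forall fun _ => norm_nonneg _) ?_ hlim
  have e1 : ∀ᶠ r in 𝓝[>] (0 : ℝ), r < x :=
    (eventually_lt_nhds hx).filter_mono nhdsWithin_le_nhds
  filter_upwards [hcap, e1, self_mem_nhdsWithin] with r hr hrx hr0
  simp only [mem_Ioi] at hr0
  have hmain := norm_setIntegral_gegenbauerShift_sub_le hlam hf hx.le hr0 (f (Real.cosh x)) hr
  have hH := le_gegenbauerMeasure_gegenbauerH hlam hr0
  set h := (gegenbauerMeasure lam).real (gegenbauerH 0 r) with h_def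
  have hHpos : 0 < h := lt_of_lt_of_le (by positivity) hH
  -- As `r < x`, the density on the ball is at most `sh^{2λ}(2x)`, independently of `r`.
  have hball : (gegenbauerMeasure lam).real (Metric.closedBall x r)
      ≤ Real.sinh (x + x) ^ (2 * lam) * (2 * r) :=
    (gegenbauerMeasure_closedBall_le hlam hr0.le (by positivity)).trans <|
      mul_le_mul_of_nonneg_right (Real.rpow_le_rpow (Real.sinh_nonneg_iff.2 (by positivity))
        (Real.sinh_le_sinh.2 (by linarith)) (by positivity)) (by positivity)
  set A := ⨍ z in Metric.closedBall x r, ‖f (Real.cosh z) - f (Real.cosh x)‖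
    ∂gegenbauerMeasure lam with hA_def
  have hA0 : 0 ≤ A := by
    rw [hA_def, setAverage_eq, smul_eq_mul]
    exact mul_nonneg (by positivity) (integral_nonneg fun _ => norm_nonneg _)
  have hA : ∫ z in Metric.closedBall x r, ‖f (Real.cosh z) - f (Real.cosh x)‖
      ∂gegenbauerMeasure lam = (gegenbauerMeasure lam).real (Metric.closedBall x r) * A := by
    rw [← smul_eq_mul, hA_def]
    exact (measure_smul_setAverage _ (isCompact_closedBall x r).measure_lt_top.ne).symm
  rw [hA] at hmain
  have hsplit : ∀ v : 𝕜, h⁻¹ • v - f (Real.cosh x) = h⁻¹ • (v - h • f (Real.cosh x)) := fun v => by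
    rw [smul_sub, smul_smul, inv_mul_cancel₀ hHpos.ne', one_smul]
  rw [hsplit, norm_smul, Real.norm_of_nonneg (by positivity), inv_mul_le_iff₀ hHpos]
  refine hmain.trans ?_
  have hpow : r ^ (2 * lam + 1) = r ^ (2 * lam) * r := by
    rw [Real.rpow_add hr0, Real.rpow_one]
  rw [div_le_iff₀ (by positivity), hpow] at hH
  calc c * (C * r ^ (2 * lam) * ((gegenbauerMeasure lam).real (Metric.closedBall x r) * A))
      ≤ c * (C * r ^ (2 * lam) * (Real.sinh (x + x) ^ (2 * lam) * (2 * r) * A)) := by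
        gcongr
    _ = (r ^ (2 * lam) * r) * (c * C * (Real.sinh (x + x) ^ (2 * lam) * 2) * A) := by ring
    -- The kernel bound `r^{2λ}` and the ball's factor `r` are absorbed together by the lower bound
    -- for `h`.
    _ ≤ (h * (2 * lam + 1)) * (c * C * (Real.sinh (x + x) ^ (2 * lam) * 2) * A) := by
        gcongr
    _ = _ := by ring

end Shift

/-! ### Conclusion at Lebesgue points. -/

theorem corollary1 {𝕜 : Type*} [RCLike 𝕜] (lam : ℝ) (hlam : 0 < lam)
    (p : ℝ≥0∞) (hp : 1 ≤ p) (f : ℝ → 𝕜) (hf : MemGegenbauerLp lam p f) :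
    ∀ᵐ x ∂(volume.restrict (Ici (0 : ℝ))),
      -- the integral defining the shift converges for almost every `t ≥ 0`
      (∀ᵐ t ∂(volume.restrict (Ici (0 : ℝ))),
        IntervalIntegrable (gegenbauerShiftIntegrand lam f t x) volume 0 Real.pi) ∧
      -- the averages over `H(0, r)` are those of an integrable function
      (∀ r : ℝ, 0 < r →
        IntegrableOn (fun t => gegenbauerShift lam f t x) (gegenbauerH 0 r)
          (gegenbauerMeasure lam)) ∧
      Tendsto
        (fun r : ℝ => ((gegenbauerMeasure lam).real (gegenbauerH 0 r))⁻¹ •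
          ∫ t in gegenbauerH 0 r, gegenbauerShift lam f t x ∂(gegenbauerMeasure lam))
        (𝓝[>] 0) (𝓝 (f (Real.cosh x))) := by
  have := isLocallyFiniteMeasure_gegenbauerMeasure hlam
  have hac := restrict_Ici_absolutelyContinuous_gegenbauerMeasure lam
  have hloc : LocallyIntegrable (fun t => f (Real.cosh t)) (gegenbauerMeasure lam) :=
    MemLp.locallyIntegrable hf hp
  -- Lebesgue-null and `μ`-null subsets of the half-line agree in the direction needed, so one may
  -- work at `μ`-almost every `x`, discarding `x = 0`. Besicovitch differentiation asks no doubling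
  -- of `μ`.
  refine hac ?_
  filter_upwards [(Besicovitch.vitaliFamily (gegenbauerMeasure lam)).ae_tendsto_average_norm_sub
    hloc, ae_gegenbauerMeasure_pos lam] with x hleb hx
  exact ⟨hac (ae_intervalIntegrable_gegenbauerShiftIntegrand hlam hloc hx.le),
    fun r hr => integrableOn_gegenbauerShift hlam hloc hx.le hr,
    tendsto_average_gegenbauerShift hlam hloc hx
      (hleb.comp (Besicovitch.tendsto_filterAt _ x))⟩
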